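/- Let $R$ be a (Noetherian) regular local ring of dimension $2$ with maximal ideal $\mathfrak m$. Let $\mathcal V$ be the set of functions $\nu : R \to \mathbb R\cup\{\infty\}$ such that $\nu(0)=\infty$, $\nu(1)=0$, $\nu(fg)=\nu(f)+\nu(g)$ and $\nu(f+g)\ge\min(\nu(f),\nu(g))$ for all $f,g\in R$, with $\nu\ge 0$ on $R$, $\nu>0$ on $\mathfrak m$, and $\inf\{\nu(f) : f\in\mathfrak m\}=1$ (the value $\infty$ is allowed at non-zero elements). Order $\mathcal V$ by: $\mu\le\nu$ if and only if $\mu(f)\le\nu(f)$ for all $f\in R$. Then $\mathcal V$ is a complete rooted non-metric tree whose root is the multiplicity valuation; that is: (T1) for every $\tau\in\mathcal V$ the set $\{\sigma\in\mathcal V : \sigma\le\tau\}$ is isomorphic, as an ordered set, to a real interval (possibly reduced to a point); (T2) every totally ordered convex subset of $\mathcal V$ is isomorphic, as an ordered set, to a real interval (possibly empty or reduced to a point), where $S$ is convex if $\sigma\le\rho\le\tau$ with $\sigma,\tau\in S$ implies $\rho\in S$; (T3) every non-empty subset of $\mathcal V$ has an infimum in $\mathcal V$; (completeness) for every sequence $\tau_1\le\tau_2\le\cdots$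 in $\mathcal V$ there is $\tau_\infty\in\mathcal V$ with $\tau_i\le\tau_\infty$ for all $i$; (root) the function $\nu_{\mathfrak m}$ given by $\nu_{\mathfrak m}(0)=\infty$ and $\nu_{\mathfrak m}(f)=\max\{i\ge 0 : f\in\mathfrak m^i\}$ for $f\ne 0$ belongs to $\mathcal V$ and is its smallest element. -/

import Mathlib

namespace ValuativeTree

section Valuations

variable {R : Type*} [CommRing R] [IsLocalRing R]

/-- `ν` is centered at the local ring `R`: non-negative on `R`, positive on the maximal ideal. -/
def IsCentered (ν : AddValuation R (WithTop ℝ)) : Prop :=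
  (∀ f : R, 0 ≤ ν f) ∧ ∀ f ∈ IsLocalRing.maximalIdeal R, 0 < ν f

/-- `ν` is proper: not identically `0` on the non-zero elements, and not identically `∞` on the
maximal ideal. -/
def IsProper (ν : AddValuation R (WithTop ℝ)) : Prop :=
  (∃ f : R, f ≠ 0 ∧ ν f ≠ 0) ∧ ∃ f ∈ IsLocalRing.maximalIdeal R, ν f ≠ ⊤

/-- `ν` is normalized: the infimum of its values on the maximal ideal is `1`. -/
def IsNormalized (ν : AddValuation R (WithTop ℝ)) : Prop :=
  IsGLB ((fun f : R => ν f) '' (IsLocalRing.maximalIdeal R : Set R)) 1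

/-- `ν` is the multiplicity valuation: `ν f = max {i | f ∈ 𝔪 ^ i}` for `f ≠ 0`
(and `ν 0 = ∞`, as for every `AddValuation`). -/
def IsMultiplicityValuation (ν : AddValuation R (WithTop ℝ)) : Prop :=
  ∀ f : R, f ≠ 0 → ∃ n : ℕ,
    IsGreatest {i : ℕ | f ∈ IsLocalRing.maximalIdeal R ^ i} n ∧ ν f = ((n : ℝ) : WithTop ℝ)

end Valuations

/-- The valuation space `𝒱` of a local ring `R`: normalized proper valuations
`R → ℝ ∪ {∞}` centered at `R`. The value `∞` may be taken on a non-zero prime ideal. -/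
@[ext]
structure ValuationSpace (R : Type*) [CommRing R] [IsLocalRing R] where
  val : AddValuation R (WithTop ℝ)
  centered : IsCentered val
  proper : IsProper val
  normalized : IsNormalized val

/-- `μ ≤ ν` if and only if `μ f ≤ ν f` for all `f ∈ R`. -/
instance (R : Type*) [CommRing R] [IsLocalRing R] : PartialOrder (ValuationSpace R) where
  le μ ν := ∀ f : R, μ.val f ≤ ν.val f
  le_refl _ _ := le_rfl
  le_trans _ _ _ h₁ h₂ f := (h₁ f).trans (h₂ f)
  le_antisymm _ _ h₁ h₂ :=
    ValuationSpace.ext (AddValuation.ext fun f => le_antisymm (h₁ f) (h₂ f))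

section Trees

/-- The ordered set `S` is isomorphic to a real interval (of any kind, possibly degenerate). -/
def IsoRealInterval {T : Type*} [PartialOrder T] (S : Set T) : Prop :=
  ∃ J : Set ℝ, J.OrdConnected ∧ Nonempty (S ≃o J)

/-- Rooted non-metric trees: the conditions (T1), (T2), (T3). -/
structure IsRootedNonmetricTree (T : Type*) [PartialOrder T] : Prop where
  lowerSet_interval : ∀ τ : T, IsoRealInterval {σ : T | σ ≤ τ}
  chain_interval : ∀ S : Set T, IsChain (· ≤ ·) S → S.OrdConnected → IsoRealInterval S
  exists_inf : ∀ S : Set T, S.Nonempty → ∃ σ : T, IsGLB S σ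

/-- Complete rooted non-metric trees: every increasing sequence has a majorant. -/
structure IsCompleteRootedNonmetricTree (T : Type*) [PartialOrder T] : Prop
    extends IsRootedNonmetricTree T where
  exists_majorant : ∀ τ : ℕ → T, Monotone τ → ∃ τ' : T, ∀ i, τ i ≤ τ'

end Trees

end ValuativeTree

/-! Write `𝔪 = (x, y)` and take values in `ℝ≥0∞`. Normalization forces the value 1 at `x` or at `y`;
if `τ x = 1`, then `σ x = 1` for every `σ ≤ τ`. Each non-zero element is a power of `x` times an
element congruent to a unit times `y ^ d` modulo `x`. The exponent `d` serves as a degree, and there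
is a Weierstrass division (`HasDeg.exists_div`) that needs Krull's intersection theorem but no
completeness.

If `σ < τ` and `τ x = 1`, an element `φ` of least degree with `σ φ < τ φ` behaves like a MacLane key
polynomial: `σ` and `τ` agree on remainders modulo `φ`. Three facts follow. Valuations below `τ` are
totally ordered, by comparing values at the key of smaller degree (`le_total_of_le`). Augmenting `σ`
at `φ` gives valuations between `σ` and `τ` arbitrarily close to `σ` (`exists_lt_le_mul`). And `σ φ`
is the largest value of `σ` in degree `d`, so the suprema of values over each degree separate
comparable valuations (`exists_supDeg_lt`).

Chains have pointwise suprema, which gives completeness. A weighted sum of the degreewise suprema is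
a strictly increasing real parameter; pointwise suprema and the closeness property give it the
intermediate value property (`exists_param_eq`), so convex chains are real intervals. The root is
the augmentation of the `x`-adic valuation that gives `y` the value 1. Since there is a root, infima
are suprema of lower bounds. -/

open scoped ENNReal

namespace ValuativeTree

/-! ### Augmentation of a valuation at a key element. -/

section Augmentation

variable {R : Type*} [CommRing R]

/-- `AugGE μ φ γ c f` says that `f` has a finite expansion `∑ bᵢ φ ^ i` with
`c ≤ μ bᵢ + i γ` for all `i`. -/
inductive AugGE (μ : AddValuation R ℝ≥0∞) (φ : R) (γ : ℝ≥0∞) : ℝ≥0∞ → R → Prop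
  | of_le {c : ℝ≥0∞} {b : R} : c ≤ μ b → AugGE μ φ γ c b
  | step {c c' : ℝ≥0∞} {b s : R} :
      c ≤ μ b → AugGE μ φ γ c' s → c ≤ c' + γ → AugGE μ φ γ c (b + s * φ)

variable {μ ν : AddValuation R ℝ≥0∞} {φ : R} {γ : ℝ≥0∞}

theorem AugGE.mono {c c' : ℝ≥0∞} {f : R} (h : AugGE μ φ γ c f) (hc : c' ≤ c) :
    AugGE μ φ γ c' f := by
  cases h with
  | of_le h => exact .of_le (hc.trans h)
  | step h₁ h₂ h₃ => exact .step (hc.trans h₁) h₂ (hc.trans h₃)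

theorem AugGE.add {c c' : ℝ≥0∞} {f g : R} (hf : AugGE μ φ γ c f) (hg : AugGE μ φ γ c' g) :
    AugGE μ φ γ (min c c') (f + g) := by
  induction hf generalizing c' g with
  | @of_le c b h =>
    cases hg with
    | of_le h' => exact .of_le ((min_le_min h h').trans (μ.map_add _ _))
    | step h₁ h₂ h₃ =>
      rw [← add_assoc]
      exact .step ((min_le_min h h₁).trans (μ.map_add _ _)) h₂ ((min_le_right _ _).trans h₃)
  | @step c c₁ b s h₁ h₂ h₃ ih =>
    cases hg with
    | of_le h' =>
      rw [add_right_comm]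
      exact .step ((min_le_min h₁ h').trans (μ.map_add _ _)) h₂ ((min_le_left _ _).trans h₃)
    | @step _ c₂ b' s' h₁' h₂' h₃' =>
      rw [show b + s * φ + (b' + s' * φ) = (b + b') + (s + s') * φ by ring]
      refine .step ((min_le_min h₁ h₁').trans (μ.map_add _ _)) (ih h₂') ?_
      rw [← min_add_add_right]
      exact min_le_min h₃ h₃'

theorem AugGE.mul_key {c : ℝ≥0∞} {f : R} (hf : AugGE μ φ γ c f) :
    AugGE μ φ γ (c + γ) (f * φ) := by
  rw [← zero_add (f * φ)]
  exact .step (by simp) hf le_rfl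

theorem AugGE.mul_left {c c' : ℝ≥0∞} {b g : R} (hb : c ≤ μ b) (hg : AugGE μ φ γ c' g) :
    AugGE μ φ γ (c + c') (b * g) := by
  induction hg with
  | of_le h => exact .of_le (by rw [μ.map_mul]; exact add_le_add hb h)
  | @step c₀ c₁ b' s h₁ h₂ h₃ ih =>
    rw [mul_add, ← mul_assoc]
    refine .step (by rw [μ.map_mul]; exact add_le_add hb h₁) ih ?_
    rw [add_assoc]
    gcongr

theorem AugGE.mul {c c' : ℝ≥0∞} {f g : R} (hf : AugGE μ φ γ c f) (hg : AugGE μ φ γ c' g) :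
    AugGE μ φ γ (c + c') (f * g) := by
  induction hf with
  | of_le h => exact hg.mul_left h
  | @step c c₁ b s h₁ h₂ h₃ ih =>
    rw [show (b + s * φ) * g = b * g + (s * g) * φ by ring]
    refine ((hg.mul_left h₁).add ih.mul_key).mono (le_min le_rfl ?_)
    rw [add_right_comm]
    gcongr

theorem AugGE.exists_step {c : ℝ≥0∞} {f : R} (hf : AugGE μ φ γ c f) :
    ∃ b s, f = b + s * φ ∧ c ≤ μ b ∧ AugGE μ φ γ (c - γ) s := by
  cases hf with
  | of_le h => exact ⟨f, 0, by simp, h, .of_le (by simp)⟩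
  | @step _ c' b s h₁ h₂ h₃ => exact ⟨b, s, rfl, h₁, h₂.mono (tsub_le_iff_right.2 h₃)⟩

/-- Minimality of the augmentation. Here `ρ` need not be a valuation: the bound is also applied to a
multiple `t * σ` of a valuation. -/
theorem AugGE.le {ρ : R → ℝ≥0∞} (hadd : ∀ f g, min (ρ f) (ρ g) ≤ ρ (f + g))
    (hmul : ∀ f g, ρ (f * g) = ρ f + ρ g) (hμ : ∀ f, μ f ≤ ρ f) (hγ : γ ≤ ρ φ)
    {c : ℝ≥0∞} {f : R} (hf : AugGE μ φ γ c f) : c ≤ ρ f := by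
  induction hf with
  | of_le h => exact h.trans (hμ _)
  | step h₁ h₂ h₃ ih =>
    refine (le_min (h₁.trans (hμ _)) (h₃.trans ?_)).trans (hadd _ _)
    rw [hmul]
    exact add_le_add ih hγ

/-- `φ` is a key element for `μ ≤ ν`: its value increases strictly, and it divides every element
up to a remainder on which `μ` and `ν` agree. -/
structure IsKey (μ ν : AddValuation R ℝ≥0∞) (φ : R) : Prop where
  le : ∀ f, μ f ≤ ν f
  lt : μ φ < ν φ
  exists_div : ∀ f, ∃ a q, f = a + q * φ ∧ μ a = ν a

theorem lt_mul_key (hle : ∀ f, μ f ≤ ν f) (hlt : μ φ < ν φ) {q : R} (hq : μ (q * φ) ≠ ⊤) :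
    μ (q * φ) < ν (q * φ) := by
  rw [μ.map_mul] at hq ⊢
  rw [ν.map_mul]
  exact ENNReal.add_lt_add_of_le_of_lt (ne_top_of_le_ne_top hq le_self_add) (hle q) hlt

/-- Only the case `μ a = μ (q * φ)` could allow cancellation. There `ν` strictly raises the value of
`q * φ` but not that of `a`, so `ν`, and hence `μ`, cannot exceed `μ a` on the sum. -/
theorem map_add_mul_key_le (hle : ∀ f, μ f ≤ ν f) (hlt : μ φ < ν φ) {a q : R} (ha : μ a = ν a) :
    μ (a + q * φ) ≤ μ a ∧ μ (a + q * φ) ≤ μ (q * φ) := by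
  rcases lt_trichotomy (μ a) (μ (q * φ)) with h | h | h
  · rw [μ.map_add_eq_of_lt_left h]
    exact ⟨le_rfl, h.le⟩
  · rw [← h, and_self]
    by_cases htop : μ (q * φ) = ⊤
    · simp [h, htop]
    have h' : ν a < ν (q * φ) := by
      rw [← ha, h]
      exact lt_mul_key hle hlt htop
    calc μ (a + q * φ) ≤ ν (a + q * φ) := hle _
      _ = ν a := ν.map_add_eq_of_lt_left h'
      _ = μ a := ha.symm
  · rw [μ.map_add_eq_of_lt_right h]
    exact ⟨h.le, le_rfl⟩

/-- Division by `φ` is an optimal first step of an expansion. If `b + s * φ` is another one, then `b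
= a + (q - s) * φ` has no cancellation under `μ`, so `μ b` bounds both `a` and the correction `q -
s` from below. -/
theorem AugGE.of_add_mul_key (hle : ∀ f, μ f ≤ ν f) (hlt : μ φ < ν φ) (hγ : μ φ ≤ γ)
    {a q : R} (ha : μ a = ν a) {c : ℝ≥0∞} (h : AugGE μ φ γ c (a + q * φ)) :
    c ≤ μ a ∧ AugGE μ φ γ (c - γ) q := by
  obtain ⟨b, s, hbs, hb, hs⟩ := h.exists_step
  have hab : a + (q - s) * φ = b := by linear_combination hbs
  have key := map_add_mul_key_le hle hlt (q := q - s) ha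
  rw [hab] at key
  refine ⟨hb.trans key.1, ?_⟩
  have hqs : AugGE μ φ γ (c - γ) (q - s) := by
    refine .of_le (tsub_le_iff_right.2 ?_)
    rw [μ.map_mul] at key
    exact (hb.trans key.2).trans (by gcongr)
  simpa using hs.add hqs

/-- The value function of the augmentation of `μ` assigning `γ` to `φ`. -/
noncomputable def augFun (μ : AddValuation R ℝ≥0∞) (φ : R) (γ : ℝ≥0∞) (f : R) : ℝ≥0∞ :=
  ⨆ c : {c // AugGE μ φ γ c f}, (c : ℝ≥0∞)

theorem AugGE.le_augFun {c : ℝ≥0∞} {f : R} (h : AugGE μ φ γ c f) : c ≤ augFun μ φ γ f :=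
  le_iSup (fun c : {c // AugGE μ φ γ c f} => (c : ℝ≥0∞)) ⟨c, h⟩

theorem augFun_le {f : R} {d : ℝ≥0∞} (h : ∀ c, AugGE μ φ γ c f → c ≤ d) : augFun μ φ γ f ≤ d :=
  iSup_le fun c => h c c.2

theorem exists_augGE_of_lt {f : R} {d : ℝ≥0∞} (h : d < augFun μ φ γ f) :
    ∃ c, d < c ∧ AugGE μ φ γ c f := by
  obtain ⟨c, hc⟩ := lt_iSup_iff.1 h
  exact ⟨c, hc, c.2⟩

theorem le_augFun (f : R) : μ f ≤ augFun μ φ γ f := AugGE.le_augFun (.of_le le_rfl)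

theorem min_le_augFun_add (f g : R) :
    min (augFun μ φ γ f) (augFun μ φ γ g) ≤ augFun μ φ γ (f + g) := by
  refine le_of_forall_lt fun d hd => ?_
  obtain ⟨c, hc, hf⟩ := exists_augGE_of_lt (lt_min_iff.1 hd).1
  obtain ⟨c', hc', hg⟩ := exists_augGE_of_lt (lt_min_iff.1 hd).2
  exact (lt_min hc hc').trans_le (hf.add hg).le_augFun

theorem add_le_augFun_mul (f g : R) :
    augFun μ φ γ f + augFun μ φ γ g ≤ augFun μ φ γ (f * g) := by
  have : ∀ f, Nonempty {c // AugGE μ φ γ c f} := fun f => ⟨⟨0, .of_le (zero_le)⟩⟩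
  exact ENNReal.iSup_add_iSup_le fun c c' => (c.2.mul c'.2).le_augFun

theorem augFun_add_mul_key (hle : ∀ f, μ f ≤ ν f) (hlt : μ φ < ν φ) (hγ : μ φ ≤ γ)
    {a q : R} (ha : μ a = ν a) :
    augFun μ φ γ (a + q * φ) = min (μ a) (augFun μ φ γ q + γ) := by
  refine le_antisymm (augFun_le fun c hc => ?_) ?_
  · obtain ⟨h₁, h₂⟩ := hc.of_add_mul_key hle hlt hγ ha
    exact le_min h₁ (le_tsub_add.trans (add_le_add_left h₂.le_augFun _))
  · have hφ : γ ≤ augFun μ φ γ φ := by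
      have : AugGE μ φ γ 0 1 := .of_le (zero_le)
      simpa using this.mul_key.le_augFun
    refine (min_le_min (le_augFun a) ?_).trans (min_le_augFun_add _ _)
    exact (add_le_add_right hφ _).trans (add_le_augFun_mul _ _)

theorem augFun_mul_key (hle : ∀ f, μ f ≤ ν f) (hlt : μ φ < ν φ) (hγ : μ φ ≤ γ) (q : R) :
    augFun μ φ γ (q * φ) = augFun μ φ γ q + γ := by
  simpa using augFun_add_mul_key (a := 0) (q := q) hle hlt hγ (by simp)

theorem augFun_neg_le (f : R) : augFun μ φ γ f ≤ augFun μ φ γ (-f) := by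
  have h := add_le_augFun_mul (μ := μ) (φ := φ) (γ := γ) (-1) f
  rw [neg_one_mul] at h
  exact le_add_self.trans h

/-- If the product had too large a value, subtracting `a * g`, whose value is also too large, would
leave `q * g * φ` with a value contradicting the bound for `q * g`. -/
theorem augFun_mul_le_of_lt (hle : ∀ f, μ f ≤ ν f) (hlt : μ φ < ν φ) (hγ : μ φ ≤ γ)
    {a q g : R} (ha : μ a = ν a) (hg : augFun μ φ γ g ≠ ⊤) (h : augFun μ φ γ q + γ < μ a)
    (ih : augFun μ φ γ (q * g) ≤ augFun μ φ γ q + augFun μ φ γ g) :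
    augFun μ φ γ ((a + q * φ) * g) ≤ augFun μ φ γ (a + q * φ) + augFun μ φ γ g := by
  rw [augFun_add_mul_key hle hlt hγ ha, min_eq_right h.le]
  by_contra! hc
  have h₁ : augFun μ φ γ q + γ + augFun μ φ γ g < augFun μ φ γ (-(a * g)) := by
    refine lt_of_lt_of_le ?_ (augFun_neg_le _)
    refine lt_of_lt_of_le ?_ ((add_le_add_left (le_augFun a) _).trans (add_le_augFun_mul _ _))
    exact ENNReal.add_lt_add_right hg h
  have h₂ := (lt_min hc h₁).trans_le (min_le_augFun_add _ _)
  rw [show (a + q * φ) * g + -(a * g) = (q * g) * φ by ring, augFun_mul_key hle hlt hγ,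
    add_right_comm] at h₂
  exact absurd h₂ (not_lt.2 (add_le_add_left ih _))

/-- When both remainders dominate, `a * b` is itself an admissible remainder for the product, and
its value bounds the product from above. -/
theorem augFun_mul_le_of_le (hle : ∀ f, μ f ≤ ν f) (hlt : μ φ < ν φ) (hγ : μ φ ≤ γ)
    {a q b r : R} (ha : μ a = ν a) (hb : μ b = ν b)
    (h : μ a ≤ augFun μ φ γ q + γ) (h' : μ b ≤ augFun μ φ γ r + γ) :
    augFun μ φ γ ((a + q * φ) * (b + r * φ)) ≤
      augFun μ φ γ (a + q * φ) + augFun μ φ γ (b + r * φ) := by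
  have hab : μ (a * b) = ν (a * b) := by rw [μ.map_mul, ν.map_mul, ha, hb]
  rw [show (a + q * φ) * (b + r * φ) = a * b + (a * r + q * b + q * r * φ) * φ by ring,
    augFun_add_mul_key hle hlt hγ hab, augFun_add_mul_key hle hlt hγ ha,
    augFun_add_mul_key hle hlt hγ hb, min_eq_left h, min_eq_left h', ← μ.map_mul]
  exact min_le_left _ _

/-- Replacing a factor by its quotient by `φ` lowers the sum of the values by `γ` whenever the
quotient term is the smaller one. As `0 < γ < ∞`, the number `n` bounds how often this can happen.
-/
theorem augFun_mul_le (hk : IsKey μ ν φ) (h0 : 0 < γ) (hγ : μ φ ≤ γ) (htop : γ ≠ ⊤) (n : ℕ)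
    (f g : R) (hn : augFun μ φ γ f + augFun μ φ γ g ≤ n * γ) :
    augFun μ φ γ (f * g) ≤ augFun μ φ γ f + augFun μ φ γ g := by
  induction n generalizing f g with
  | zero =>
    obtain ⟨a, q, rfl, ha⟩ := hk.exists_div f
    obtain ⟨b, r, rfl, hb⟩ := hk.exists_div g
    have e₁ := augFun_add_mul_key (q := q) hk.le hk.lt hγ ha
    have e₂ := augFun_add_mul_key (q := r) hk.le hk.lt hγ hb
    simp only [Nat.cast_zero, zero_mul, nonpos_iff_eq_zero, add_eq_zero, e₁, e₂] at hn
    have key : ∀ {a q : R}, min (μ a) (augFun μ φ γ q + γ) = 0 →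
        μ a ≤ augFun μ φ γ q + γ := fun {a q} h => by
      by_contra! hc
      rw [min_eq_right hc.le] at h
      exact h0.ne' (add_eq_zero.1 h).2
    exact augFun_mul_le_of_le hk.le hk.lt hγ ha hb (key hn.1) (key hn.2)
  | succ n ih =>
    have hfin : augFun μ φ γ f + augFun μ φ γ g ≠ ⊤ :=
      ne_top_of_le_ne_top (ENNReal.mul_ne_top (ENNReal.natCast_ne_top _) htop) hn
    have ih' : ∀ p q, augFun μ φ γ p + γ + augFun μ φ γ q ≤ (n + 1 : ℕ) * γ →
        augFun μ φ γ (p * q) ≤ augFun μ φ γ p + augFun μ φ γ q := fun p q h => by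
      refine ih p q ?_
      rw [add_right_comm, Nat.cast_add, Nat.cast_one, add_mul, one_mul] at h
      exact ENNReal.le_of_add_le_add_right htop h
    obtain ⟨a, q, rfl, ha⟩ := hk.exists_div f
    obtain ⟨b, r, rfl, hb⟩ := hk.exists_div g
    have e₁ := augFun_add_mul_key (q := q) hk.le hk.lt hγ ha
    have e₂ := augFun_add_mul_key (q := r) hk.le hk.lt hγ hb
    rcases le_or_gt (μ a) (augFun μ φ γ q + γ) with h | h
    · rcases le_or_gt (μ b) (augFun μ φ γ r + γ) with h' | h'
      · exact augFun_mul_le_of_le hk.le hk.lt hγ ha hb h h'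
      · rw [mul_comm, add_comm (augFun μ φ γ (a + q * φ))]
        refine augFun_mul_le_of_lt hk.le hk.lt hγ hb
          (ne_top_of_le_ne_top hfin le_self_add) h' (ih' _ _ ?_)
        rwa [e₂, min_eq_right h'.le, add_comm] at hn
    · refine augFun_mul_le_of_lt hk.le hk.lt hγ ha
        (ne_top_of_le_ne_top hfin le_add_self) h (ih' _ _ ?_)
      rwa [e₁, min_eq_right h.le] at hn

theorem augFun_mul (hk : IsKey μ ν φ) (h0 : 0 < γ) (hγ : μ φ ≤ γ) (htop : γ ≠ ⊤) (f g : R) :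
    augFun μ φ γ (f * g) = augFun μ φ γ f + augFun μ φ γ g := by
  refine le_antisymm ?_ (add_le_augFun_mul f g)
  by_cases hfin : augFun μ φ γ f + augFun μ φ γ g = ⊤
  · simp [hfin]
  obtain ⟨n, hn⟩ := ENNReal.exists_nat_mul_gt h0.ne' hfin
  exact augFun_mul_le hk h0 hγ htop n f g hn.le

theorem augFun_le_of_le {ρ : R → ℝ≥0∞} (hadd : ∀ f g, min (ρ f) (ρ g) ≤ ρ (f + g))
    (hmul : ∀ f g, ρ (f * g) = ρ f + ρ g) (hμ : ∀ f, μ f ≤ ρ f) (hγ : γ ≤ ρ φ) (f : R) :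
    augFun μ φ γ f ≤ ρ f :=
  augFun_le fun _ hc => hc.le hadd hmul hμ hγ

theorem augFun_one (hle : ∀ f, μ f ≤ ν f) (hγ' : γ ≤ ν φ) : augFun μ φ γ 1 = 0 := by
  have h := augFun_le_of_le ν.map_add ν.map_mul hle hγ' 1
  rwa [ν.map_one, nonpos_iff_eq_zero] at h

/-- The augmentation of `μ` in the direction of `ν`, assigning the value `γ` to `φ`. -/
noncomputable def augmentation (hk : IsKey μ ν φ) (h0 : 0 < γ) (hγ : μ φ ≤ γ) (hγ' : γ ≤ ν φ)
    (htop : γ ≠ ⊤) : AddValuation R ℝ≥0∞ :=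
  AddValuation.of (augFun μ φ γ) (top_le_iff.1 (by simpa using le_augFun (μ := μ) (0 : R)))
    (augFun_one hk.le hγ') min_le_augFun_add (augFun_mul hk h0 hγ htop)

theorem augFun_key (hk : IsKey μ ν φ) (hγ : μ φ ≤ γ) (hγ' : γ ≤ ν φ) : augFun μ φ γ φ = γ := by
  simpa [augFun_one hk.le hγ'] using augFun_mul_key hk.le hk.lt hγ 1

end Augmentation

end ValuativeTree

namespace ValuativeTree

/-! ### Weierstrass division without completeness. -/

section Division

open IsLocalRing

variable {R : Type*} [CommRing R]

/-- The order of `f` modulo `x` along `y` is `d`: `f ≡ u y ^ d` modulo `x` for a unit `u`. -/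
def HasDeg (x y : R) (d : ℕ) (f : R) : Prop := ∃ u g, IsUnit u ∧ f = u * y ^ d + x * g

/-- `f` is zero, or a power of `x` times an element of order less than `d` modulo `x`. -/
def IsReduced (x y : R) (d : ℕ) (f : R) : Prop :=
  f = 0 ∨ ∃ k e f', e < d ∧ HasDeg x y e f' ∧ f = x ^ k * f'

theorem IsReduced.pow_mul {x y : R} {d : ℕ} {f : R} (h : IsReduced x y d f) (n : ℕ) :
    IsReduced x y d (x ^ n * f) := by
  rcases h with rfl | ⟨k, e, f', he, hf, rfl⟩
  · exact .inl (mul_zero _)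
  · exact .inr ⟨n + k, e, f', he, hf, by rw [pow_add, mul_assoc]⟩

variable [IsLocalRing R] {x y : R}

theorem mem_span_pair_left (hm : maximalIdeal R = Ideal.span {x, y}) : x ∈ maximalIdeal R :=
  hm ▸ Ideal.subset_span (by simp)

theorem mem_span_pair_right (hm : maximalIdeal R = Ideal.span {x, y}) : y ∈ maximalIdeal R :=
  hm ▸ Ideal.subset_span (by simp)

theorem span_singleton_ne_top (hx : x ∈ maximalIdeal R) : Ideal.span {x} ≠ ⊤ := by
  rw [Ne, Ideal.span_singleton_eq_top]
  exact hx

theorem span_pair_swap (hm : maximalIdeal R = Ideal.span {x, y}) :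
    maximalIdeal R = Ideal.span {y, x} := by rw [hm, Set.pair_comm]

variable [IsNoetherianRing R]

/-- Krull's intersection theorem in `R ⧸ I`. -/
theorem mem_of_forall_mem_sup_pow {I J : Ideal R} (hJ : J ≠ ⊤) {f : R}
    (h : ∀ n : ℕ, f ∈ I ⊔ J ^ n) : f ∈ I := by
  have key := Ideal.iInf_pow_smul_eq_bot_of_isLocalRing (M := R ⧸ I) J hJ
  rw [← Ideal.Quotient.eq_zero_iff_mem, ← Submodule.mem_bot (R := R), ← key, Submodule.mem_iInf]
  intro n
  obtain ⟨a, ha, b, hb, rfl⟩ := Submodule.mem_sup.1 (h n)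
  rw [map_add, Ideal.Quotient.eq_zero_iff_mem.2 ha, zero_add]
  have := Submodule.smul_mem_smul hb (Submodule.mem_top (R := R) (x := (1 : R ⧸ I)))
  rwa [Algebra.smul_def, mul_one] at this

/-- As long as the coefficient of `y ^ n` modulo `x` is not a unit, it contributes another factor
`y`. If this never stops, `f` lies in every `(x) + (y ^ n)`, hence in `(x)`. -/
theorem exists_hasDeg (hm : maximalIdeal R = Ideal.span {x, y}) {f : R} (hf : ¬ x ∣ f) :
    ∃ d, HasDeg x y d f := by
  by_contra! hd
  have key : ∀ n : ℕ, ∃ a g, f = a * y ^ n + x * g := by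
    intro n
    induction n with
    | zero => exact ⟨f, 0, by simp⟩
    | succ n ih =>
      obtain ⟨a, g, h⟩ := ih
      have ha : a ∈ maximalIdeal R := fun hu => hd n ⟨a, g, hu, h⟩
      rw [hm, Ideal.mem_span_pair] at ha
      obtain ⟨p, q, rfl⟩ := ha
      exact ⟨q, g + p * y ^ n, by rw [h]; ring⟩
  apply hf
  rw [← Ideal.mem_span_singleton]
  refine mem_of_forall_mem_sup_pow
    (J := Ideal.span {y}) (span_singleton_ne_top (mem_span_pair_right hm)) fun n => ?_
  obtain ⟨a, g, h⟩ := key n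
  rw [h, add_comm, Ideal.span_singleton_pow]
  exact Submodule.add_mem_sup (Ideal.mem_span_singleton.2 (dvd_mul_right _ _))
    (Ideal.mem_span_singleton.2 (dvd_mul_left _ _))

theorem finiteMultiplicity_of_mem (hx : x ∈ maximalIdeal R) {f : R} (hf : f ≠ 0) :
    FiniteMultiplicity x f := by
  by_contra h
  rw [FiniteMultiplicity.not_iff_forall] at h
  refine hf (Ideal.mem_bot.1 (mem_of_forall_mem_sup_pow (I := ⊥) (J := Ideal.span {x})
    (span_singleton_ne_top hx) fun n => ?_))
  rw [bot_sup_eq, Ideal.span_singleton_pow]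
  exact Ideal.mem_span_singleton.2 (h n)

theorem exists_pow_mul_hasDeg (hm : maximalIdeal R = Ideal.span {x, y}) {f : R} (hf : f ≠ 0) :
    ∃ k d f', HasDeg x y d f' ∧ f = x ^ k * f' := by
  obtain ⟨f', h, h'⟩ :=
    (finiteMultiplicity_of_mem (mem_span_pair_left hm) hf).exists_eq_pow_mul_and_not_dvd
  obtain ⟨d, hd⟩ := exists_hasDeg hm h'
  exact ⟨_, d, f', hd, h⟩

/-- If no reduced remainder ever appears, each step of the division gains a factor `x`. Then `f`
lies in every `(φ) + (x ^ n)`, so `φ` divides `f` and the remainder 0 works after all. -/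
theorem HasDeg.exists_div (hm : maximalIdeal R = Ideal.span {x, y}) {d : ℕ} {φ : R}
    (hφ : HasDeg x y d φ) (f : R) : ∃ r q, f = r + q * φ ∧ IsReduced x y d r := by
  by_contra! hc
  have key : ∀ n : ℕ, ∃ q g, f = q * φ + x ^ n * g := by
    intro n
    induction n with
    | zero => exact ⟨0, f, by simp⟩
    | succ n ih =>
      obtain ⟨q, g, h⟩ := ih
      by_cases hg : x ∣ g
      · obtain ⟨g', rfl⟩ := hg
        exact ⟨q, g', by rw [h]; ring⟩
      · obtain ⟨e, he⟩ := exists_hasDeg hm hg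
        rcases lt_or_ge e d with hed | hed
        · exact absurd (.inr ⟨n, e, g, hed, he, rfl⟩)
            (hc (x ^ n * g) q (by rw [h, add_comm]))
        · obtain ⟨u, p, hu, rfl⟩ := hφ
          obtain ⟨u', p', -, rfl⟩ := he
          obtain ⟨v, hv⟩ := hu.exists_left_inv
          obtain ⟨k, rfl⟩ := Nat.exists_eq_add_of_le hed
          refine ⟨q + x ^ n * u' * v * y ^ k, p' - u' * v * p * y ^ k, ?_⟩
          rw [h]
          linear_combination (- x ^ n * u' * y ^ (d + k)) * hv
  have hf : f ∈ Ideal.span {φ} := by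
    refine mem_of_forall_mem_sup_pow (J := Ideal.span {x})
      (span_singleton_ne_top (mem_span_pair_left hm)) fun n => ?_
    obtain ⟨q, g, h⟩ := key n
    rw [h, Ideal.span_singleton_pow]
    exact Submodule.add_mem_sup (Ideal.mem_span_singleton.2 (dvd_mul_left _ _))
      (Ideal.mem_span_singleton.2 (dvd_mul_right _ _))
  obtain ⟨q, rfl⟩ := Ideal.mem_span_singleton'.1 hf
  exact hc 0 q (by simp) (.inl rfl)

/-- Two elements of the same order differ by a unit factor, up to a reduced remainder. -/
theorem HasDeg.exists_isUnit_div (hm : maximalIdeal R = Ideal.span {x, y}) {d : ℕ} {φ f : R}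
    (hφ : HasDeg x y d φ) (hf : HasDeg x y d f) :
    ∃ r q, f = r + q * φ ∧ IsReduced x y d r ∧ IsUnit q := by
  obtain ⟨u', p', hu', rfl⟩ := hf
  obtain ⟨u, p, hu, hφe⟩ := id hφ
  obtain ⟨v, hv⟩ := hu.exists_left_inv
  -- Since `f - u' * v * φ = x * (p' - u' * v * p)`, dividing only the last factor keeps the
  -- quotient congruent to the unit `u' * v` modulo `x`.
  obtain ⟨r, q, hrq, hr⟩ := hφ.exists_div hm (p' - u' * v * p)
  refine ⟨x ^ 1 * r, u' * v + x * q, ?_, hr.pow_mul 1, ?_⟩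
  · linear_combination x * hrq - u' * v * hφe - u' * y ^ d * hv
  · by_contra hn
    have hxq : x * q ∈ maximalIdeal R := Ideal.mul_mem_right _ _ (mem_span_pair_left hm)
    have h := (maximalIdeal R).sub_mem ((mem_maximalIdeal _).2 hn) hxq
    rw [add_sub_cancel_right] at h
    exact h (hu'.mul (IsUnit.of_mul_eq_one _ hv))

end Division

/-! ### Generators of the maximal ideal; dimension two implies a domain. -/

section Regular

open IsLocalRing

variable {R : Type*} [CommRing R]

theorem exists_maximalIdeal_eq_span_pair [IsRegularLocalRing R] (hdim : ringKrullDim R = 2) :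
    ∃ x y : R, maximalIdeal R = Ideal.span {x, y} := by
  have h := IsRegularLocalRing.spanFinrank_maximalIdeal (R := R)
  rw [hdim] at h
  have h2 : (maximalIdeal R).spanFinrank = 2 := by exact_mod_cast h
  have hfg : Submodule.FG (maximalIdeal R) := (maximalIdeal R).fg_of_isNoetherianRing
  rw [← hfg.generators_ncard, Set.ncard_eq_two] at h2
  obtain ⟨x, y, -, hxy⟩ := h2
  exact ⟨x, y, by rw [← hxy, Ideal.span, Submodule.span_generators]⟩

variable [IsLocalRing R] {x y : R}

theorem height_maximalIdeal (hdim : ringKrullDim R = 2) : (maximalIdeal R).height = 2 := by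
  have h := maximalIdeal_height_eq_ringKrullDim (R := R)
  rw [hdim] at h
  exact WithBot.coe_injective h

theorem exists_prime_lt_prime_lt (hdim : ringKrullDim R = 2) :
    ∃ p q : Ideal R, p.IsPrime ∧ q.IsPrime ∧ p < q ∧ q < maximalIdeal R := by
  have h : ¬ (maximalIdeal R).height ≤ 1 := by
    rw [height_maximalIdeal hdim]
    decide
  rw [show (1 : ℕ∞) = ((1 : ℕ) : ℕ∞) from rfl, Ideal.height_le_iff] at h
  push Not at h
  obtain ⟨q, hq, hqm, hh⟩ := h
  obtain ⟨p, hp, hpq⟩ := Ideal.exists_minimalPrimes_le (I := ⊥) (J := q) bot_le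
  refine ⟨p, q, hp.1.1, hq, lt_of_le_of_ne hpq ?_, hqm⟩
  rintro rfl
  rw [Ideal.height_eq_zero_iff.2 hp] at hh
  exact absurd hh (by decide)

variable [IsNoetherianRing R]

/-- Otherwise `𝔪` would be minimal over `(x)`, against Krull's principal ideal theorem. -/
theorem not_dvd_pow (hdim : ringKrullDim R = 2) (hm : maximalIdeal R = Ideal.span {x, y}) (n : ℕ) :
    ¬ x ∣ y ^ n := by
  intro h
  have hmin : maximalIdeal R ∈ (Ideal.span {x}).minimalPrimes := by
    refine ⟨⟨inferInstance, (Ideal.span_singleton_le_iff_mem _).2 (mem_span_pair_left hm)⟩, ?_⟩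
    rintro p ⟨hp, hxp⟩ -
    rw [Ideal.span_singleton_le_iff_mem] at hxp
    have hyp : y ∈ p := hp.mem_of_pow_mem n (p.mem_of_dvd h hxp)
    rw [hm, Ideal.span_le]
    rintro z (rfl | rfl) <;> assumption
  have := Ideal.height_le_one_of_isPrincipal_of_mem_minimalPrimes _ _ hmin
  rw [height_maximalIdeal hdim] at this
  exact absurd this (by decide)

theorem HasDeg.not_dvd (hdim : ringKrullDim R = 2) (hm : maximalIdeal R = Ideal.span {x, y})
    {d : ℕ} {f : R} (hf : HasDeg x y d f) : ¬ x ∣ f := by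
  obtain ⟨u, g, hu, rfl⟩ := hf
  rw [dvd_add_left (dvd_mul_right _ _), hu.dvd_mul_left]
  exact not_dvd_pow hdim hm d

theorem isPrime_span_singleton (hdim : ringKrullDim R = 2)
    (hm : maximalIdeal R = Ideal.span {x, y}) : (Ideal.span {x}).IsPrime := by
  refine ⟨span_singleton_ne_top (mem_span_pair_left hm), fun {f g} => ?_⟩
  simp only [Ideal.mem_span_singleton]
  contrapose!
  rintro ⟨hf, hg⟩
  obtain ⟨d, u, p, hu, rfl⟩ := exists_hasDeg hm hf
  obtain ⟨e, v, q, hv, rfl⟩ := exists_hasDeg hm hg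
  refine HasDeg.not_dvd hdim hm (d := d + e)
    ⟨u * v, u * y ^ d * q + p * (v * y ^ e) + p * (x * q), hu.mul hv, by ring⟩

theorem maximalIdeal_le_of_mem (hm : maximalIdeal R = Ideal.span {x, y}) {p : Ideal R}
    (hp : p.IsPrime) {g : R} (hx : x ∈ p) (hg : g ∈ p) (hxg : ¬ x ∣ g) : maximalIdeal R ≤ p := by
  obtain ⟨d, u, q, hu, rfl⟩ := exists_hasDeg hm hxg
  have h : u * y ^ d ∈ p := by simpa using p.sub_mem hg (p.mul_mem_right q hx)
  have hy : y ∈ p := hp.mem_of_pow_mem d ((Ideal.unit_mul_mem_iff_mem p hu).1 h)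
  rw [hm, Ideal.span_le]
  rintro z (rfl | rfl) <;> assumption

/-- Take primes `p < q < 𝔪`. Then `x ∉ p`, since otherwise `x` and an element of `q \ p` would force
`q = 𝔪`; so a relation `x ^ n * g = 0` puts `g` in `p`. But `𝔪` is minimal over `(x, g)`, which
makes `q` minimal over `(g)`, contradicting `g ∈ p < q`. -/
theorem mul_ne_zero_of_dim_two (hdim : ringKrullDim R = 2)
    (hm : maximalIdeal R = Ideal.span {x, y}) {g : R} (hg : ¬ x ∣ g) (n : ℕ) : x ^ n * g ≠ 0 := by
  intro h0
  obtain ⟨p, q, hp, hq, hpq, hqm⟩ := exists_prime_lt_prime_lt hdim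
  have hxp : x ∉ p := by
    intro hx
    obtain ⟨z, hzq, hzp⟩ := Set.exists_of_ssubset hpq
    refine hqm.not_ge (maximalIdeal_le_of_mem hm hq (hpq.le hx) hzq fun hz => ?_)
    exact hzp (p.mem_of_dvd hz hx)
  have hgp : g ∈ p := by
    have : x ^ n * g ∈ p := h0 ▸ p.zero_mem
    exact (hp.mem_or_mem this).resolve_left fun h => hxp (hp.mem_of_pow_mem n h)
  have hgm : g ∈ maximalIdeal R := hqm.le (hpq.le hgp)
  have hmin : maximalIdeal R ∈ (Ideal.span {x, g}).minimalPrimes := by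
    refine ⟨⟨inferInstance, ?_⟩, ?_⟩
    · rw [Ideal.span_le]
      rintro z (rfl | rfl)
      exacts [mem_span_pair_left hm, hgm]
    · rintro r ⟨hr, hxr⟩ -
      exact maximalIdeal_le_of_mem hm hr (hxr (Ideal.subset_span (by simp)))
        (hxr (Ideal.subset_span (by simp))) hg
  have hqmin := Ideal.mem_minimalPrimes_span_of_mem_minimalPrimes_span_insert hqm x {g} hmin {g}
    (by simpa using hpq.le hgp)
    (fun z hz => Ideal.le_radical (Ideal.subset_span (Set.mem_insert_of_mem x hz)))
  exact hpq.not_ge (hqmin.2 ⟨hp, (Ideal.span_singleton_le_iff_mem _).2 hgp⟩ hpq.le)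

theorem isDomain_of_dim_two (hdim : ringKrullDim R = 2)
    (hm : maximalIdeal R = Ideal.span {x, y}) : IsDomain R := by
  have hx := mem_span_pair_left hm
  have : NoZeroDivisors R := by
    refine ⟨fun {f g} hfg => ?_⟩
    by_contra! hne
    obtain ⟨f', hf, hf'⟩ := (finiteMultiplicity_of_mem hx hne.1).exists_eq_pow_mul_and_not_dvd
    obtain ⟨g', hg, hg'⟩ := (finiteMultiplicity_of_mem hx hne.2).exists_eq_pow_mul_and_not_dvd
    rw [hf, hg, mul_mul_mul_comm, ← pow_add] at hfg
    refine mul_ne_zero_of_dim_two hdim hm (fun h => ?_) _ hfg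
    have := (isPrime_span_singleton hdim hm).mem_or_mem (Ideal.mem_span_singleton.2 h)
    simp only [Ideal.mem_span_singleton] at this
    tauto
  exact NoZeroDivisors.to_isDomain R

end Regular

end ValuativeTree

namespace ValuativeTree

/-! ### The multiplicity valuation as an augmentation. -/

section Multiplicity

open IsLocalRing

/-- The `p`-adic valuation of a prime element, with values in `ℝ≥0∞`. -/
noncomputable def adicVal {R : Type*} [CommRing R] [IsDomain R] {p : R} (hp : Prime p) :
    AddValuation R ℝ≥0∞ :=
  AddValuation.of (fun f => ((emultiplicity p f : ℕ∞) : ℝ≥0∞)) (by simp)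
    (by simp [emultiplicity_of_one_right hp.not_isUnit])
    (fun f g => by
      rw [← ENat.toENNReal_min, ENat.toENNReal_le]
      exact min_le_emultiplicity_add)
    (fun f g => by rw [emultiplicity_mul hp, ENat.toENNReal_add])

theorem adicVal_apply {R : Type*} [CommRing R] [IsDomain R] {p : R} (hp : Prime p) (f : R) :
    adicVal hp f = ((emultiplicity p f : ℕ∞) : ℝ≥0∞) := rfl

theorem natCast_le_adicVal_iff {R : Type*} [CommRing R] [IsDomain R] {p : R} (hp : Prime p) {f : R}
    {n : ℕ} : (n : ℝ≥0∞) ≤ adicVal hp f ↔ p ^ n ∣ f := by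
  rw [adicVal_apply, pow_dvd_iff_le_emultiplicity, ← ENat.toENNReal_le, ENat.toENNReal_coe]

theorem map_isUnit {R : Type*} [CommRing R] (v : AddValuation R ℝ≥0∞) {u : R} (hu : IsUnit u) :
    v u = 0 := by
  obtain ⟨w, hw⟩ := hu.exists_left_inv
  have h := v.map_mul w u
  rw [hw, v.map_one] at h
  exact (add_eq_zero.1 h.symm).2

theorem natCast_le_of_mem_pow {R : Type*} [CommRing R] {v : AddValuation R ℝ≥0∞} {I : Ideal R}
    (hv : ∀ f ∈ I, 1 ≤ v f) (n : ℕ) {f : R} (hf : f ∈ I ^ n) : (n : ℝ≥0∞) ≤ v f := by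
  induction n generalizing f with
  | zero => simp
  | succ n ih =>
    rw [pow_succ] at hf
    refine Submodule.mul_induction_on hf (fun a ha b hb => ?_) fun a b ha hb => v.map_le_add ha hb
    rw [v.map_mul, Nat.cast_add, Nat.cast_one]
    exact add_le_add (ih ha) (hv b hb)

variable {R : Type*} [CommRing R] [IsLocalRing R] [IsNoetherianRing R] {x y : R}

theorem prime_left (hdim : ringKrullDim R = 2) (hm : maximalIdeal R = Ideal.span {x, y}) :
    Prime x := by
  refine (Ideal.span_singleton_prime ?_).1 (isPrime_span_singleton hdim hm)
  rintro rfl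
  have := not_dvd_pow hdim (span_pair_swap hm) 1
  simp at this

/-- Divisibility by `x` modulo `y` is membership in the prime ideal `𝔪`. -/
theorem prime_mk_left (hdim : ringKrullDim R = 2) (hm : maximalIdeal R = Ideal.span {x, y}) :
    Prime (Ideal.Quotient.mk (Ideal.span {y}) x) := by
  have hd := not_dvd_pow hdim (span_pair_swap hm)
  refine ⟨?_, ?_, ?_⟩
  · rw [Ne, Ideal.Quotient.eq_zero_iff_mem, Ideal.mem_span_singleton]
    simpa using hd 1
  · intro hu
    obtain ⟨b, hb⟩ := hu.exists_left_inv
    obtain ⟨b, rfl⟩ := Ideal.Quotient.mk_surjective b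
    rw [← map_mul, ← map_one (Ideal.Quotient.mk _), Ideal.Quotient.eq,
      Ideal.mem_span_singleton] at hb
    obtain ⟨c, hc⟩ := hb
    have : (1 : R) ∈ maximalIdeal R := by
      rw [hm, Ideal.mem_span_pair]
      exact ⟨b, -c, by linear_combination hc⟩
    exact this isUnit_one
  · intro a b hab
    obtain ⟨a, rfl⟩ := Ideal.Quotient.mk_surjective a
    obtain ⟨b, rfl⟩ := Ideal.Quotient.mk_surjective b
    have key : ∀ f : R, Ideal.Quotient.mk (Ideal.span {y}) x ∣ Ideal.Quotient.mk _ f ↔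
        f ∈ maximalIdeal R := by
      intro f
      constructor
      · rintro ⟨c, hc⟩
        obtain ⟨c, rfl⟩ := Ideal.Quotient.mk_surjective c
        rw [← map_mul, Ideal.Quotient.eq, Ideal.mem_span_singleton] at hc
        obtain ⟨e, he⟩ := hc
        rw [hm, Ideal.mem_span_pair]
        exact ⟨c, e, by linear_combination -he⟩
      · rw [hm, Ideal.mem_span_pair]
        rintro ⟨c, e, rfl⟩
        refine ⟨Ideal.Quotient.mk _ c, ?_⟩
        rw [← map_mul, Ideal.Quotient.eq, Ideal.mem_span_singleton]
        exact ⟨e, by ring⟩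
    rw [← map_mul, key] at hab
    rw [key, key]
    exact Ideal.IsPrime.mem_or_mem inferInstance hab

/-- The order of vanishing along `x` on the curve `y = 0`. -/
noncomputable def curveVal (hdim : ringKrullDim R = 2) (hm : maximalIdeal R = Ideal.span {x, y}) :
    AddValuation R ℝ≥0∞ :=
  have := isPrime_span_singleton hdim (span_pair_swap hm)
  (adicVal (prime_mk_left hdim hm)).comap (Ideal.Quotient.mk (Ideal.span {y}))

theorem curveVal_apply (hdim : ringKrullDim R = 2) (hm : maximalIdeal R = Ideal.span {x, y})
    (f : R) : curveVal hdim hm f =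
      ((emultiplicity (Ideal.Quotient.mk (Ideal.span {y}) x)
        (Ideal.Quotient.mk (Ideal.span {y}) f) : ℕ∞) : ℝ≥0∞) := rfl

variable [IsDomain R]

/-- An element not divisible by `y` is `u * x ^ d` modulo `y` with `u` a unit, and `u * x ^ d` has
value `d` under both valuations. -/
theorem isKey_adicVal_curveVal (hdim : ringKrullDim R = 2)
    (hm : maximalIdeal R = Ideal.span {x, y}) :
    IsKey (adicVal (prime_left hdim hm)) (curveVal hdim hm) y where
  le f := by
    rw [adicVal_apply, curveVal_apply, ENat.toENNReal_le, emultiplicity_le_emultiplicity_iff]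
    intro n h
    rw [← map_pow]
    exact map_dvd _ h
  lt := by
    have h : Ideal.Quotient.mk (Ideal.span {y}) y = 0 :=
      Ideal.Quotient.eq_zero_iff_mem.2 (Ideal.mem_span_singleton_self y)
    rw [adicVal_apply, curveVal_apply, h, emultiplicity_zero, ENat.toENNReal_lt,
      emultiplicity_lt_top]
    exact finiteMultiplicity_of_mem (mem_span_pair_left hm)
      (prime_left hdim (span_pair_swap hm)).ne_zero
  exists_div f := by
    by_cases hf : y ∣ f
    · obtain ⟨q, rfl⟩ := hf
      exact ⟨0, q, by ring, by simp⟩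
    · obtain ⟨d, u, q, hu, rfl⟩ := exists_hasDeg (span_pair_swap hm) hf
      refine ⟨u * x ^ d, q, by ring, ?_⟩
      have := isPrime_span_singleton hdim (span_pair_swap hm)
      have hx := prime_left hdim hm
      have hx' := prime_mk_left hdim hm
      rw [AddValuation.map_mul, AddValuation.map_mul, map_isUnit _ hu, map_isUnit _ hu,
        adicVal_apply, curveVal_apply, map_pow, emultiplicity_pow_self hx.ne_zero hx.not_isUnit,
        emultiplicity_pow_self hx'.ne_zero hx'.not_isUnit]

theorem adicVal_right (hdim : ringKrullDim R = 2) (hm : maximalIdeal R = Ideal.span {x, y}) :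
    adicVal (prime_left hdim hm) y = 0 := by
  rw [adicVal_apply, emultiplicity_eq_zero.2 (by simpa using not_dvd_pow hdim hm 1)]
  simp

/-- The bound `c` need not be an integer, but `x`-adic values are, so `c > n - 1` already gives `n`
factors `x`. Each factor `y` lowers both `c` and `n` by 1. -/
theorem AugGE.mem_maximalIdeal_pow (hdim : ringKrullDim R = 2)
    (hm : maximalIdeal R = Ideal.span {x, y}) {c : ℝ≥0∞} {f : R}
    (h : AugGE (adicVal (prime_left hdim hm)) y 1 c f) (n : ℕ) (hn : (n : ℝ≥0∞) < c + 1) :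
    f ∈ maximalIdeal R ^ n := by
  have base : ∀ {c : ℝ≥0∞} {b : R} (n : ℕ), (n : ℝ≥0∞) < c + 1 →
      c ≤ adicVal (prime_left hdim hm) b → b ∈ maximalIdeal R ^ n := by
    intro c b n hn hb
    refine Ideal.mem_of_dvd _ ((natCast_le_adicVal_iff (prime_left hdim hm)).1 ?_)
      (Ideal.pow_mem_pow (mem_span_pair_left hm) n)
    have h₁ := hn.trans_le (add_le_add_left hb 1)
    rw [adicVal_apply, ← ENat.toENNReal_one, ← ENat.toENNReal_add, ← ENat.toENNReal_coe,
      ENat.toENNReal_lt] at h₁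
    rw [adicVal_apply, ← ENat.toENNReal_coe, ENat.toENNReal_le]
    rcases eq_or_ne (emultiplicity x b) ⊤ with h | h
    · simp [h]
    · exact (ENat.lt_add_one_iff h).1 h₁
  induction h generalizing n with
  | of_le h => exact base n hn h
  | @step c c' b s h₁ h₂ h₃ ih =>
    refine add_mem (base n hn h₁) ?_
    cases n with
    | zero => simp
    | succ n =>
      rw [pow_succ]
      refine Ideal.mul_mem_mul (ih n ?_) (mem_span_pair_right hm)
      have h := hn.trans_le (add_le_add_left h₃ 1)
      rw [Nat.cast_add, Nat.cast_one] at h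
      exact lt_of_add_lt_add_right h

/-- Giving `x` and `y` the value 1 makes an expansion in powers of `y` of value above `n` a witness
of membership in `𝔪 ^ (n + 1)`. This bounds the value above by the multiplicity; the reverse bound
holds for every valuation that is at least 1 on `𝔪`. -/
theorem exists_multiplicity_addValuation (hdim : ringKrullDim R = 2)
    (hm : maximalIdeal R = Ideal.span {x, y}) :
    ∃ v : AddValuation R ℝ≥0∞, (∀ f ∈ maximalIdeal R, 1 ≤ v f) ∧ v y = 1 ∧
      ∀ f, f ≠ 0 → ∃ n : ℕ, IsGreatest {i : ℕ | f ∈ maximalIdeal R ^ i} n ∧ v f = n := by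
  have hk := isKey_adicVal_curveVal hdim hm
  have hy : curveVal hdim hm y = ⊤ := by
    rw [curveVal_apply, Ideal.Quotient.eq_zero_iff_mem.2 (Ideal.mem_span_singleton_self y)]
    simp
  have hγ : adicVal (prime_left hdim hm) y ≤ 1 := by simp [adicVal_right hdim hm]
  let v := augmentation hk one_pos hγ (by simp [hy]) ENNReal.one_ne_top
  have hvx : 1 ≤ v x := by
    refine le_trans ?_ (le_augFun x)
    simpa using (natCast_le_adicVal_iff (prime_left hdim hm) (f := x) (n := 1)).2 (by simp)
  have hvy : v y = 1 := augFun_key hk hγ (by simp [hy])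
  have hv : ∀ f ∈ maximalIdeal R, 1 ≤ v f := by
    intro f hf
    rw [hm, Ideal.mem_span_pair] at hf
    obtain ⟨a, b, rfl⟩ := hf
    refine v.map_le_add ?_ ?_ <;> rw [v.map_mul]
    exacts [hvx.trans le_add_self, hvy.ge.trans le_add_self]
  refine ⟨v, hv, hvy, fun f hf => ?_⟩
  have hex : ∃ n, f ∉ maximalIdeal R ^ n := by
    by_contra! hc
    exact hf (Ideal.mem_bot.1 (mem_of_forall_mem_sup_pow (I := ⊥) (J := maximalIdeal R)
      Ideal.IsPrime.ne_top' fun n => by simpa using hc n))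
  classical
  obtain ⟨n, hn⟩ : ∃ n, Nat.find hex = n + 1 := by
    refine Nat.exists_eq_succ_of_ne_zero fun h0 => ?_
    have := Nat.find_spec hex
    rw [h0] at this
    simp at this
  have hnot : f ∉ maximalIdeal R ^ (n + 1) := hn ▸ Nat.find_spec hex
  have hmem : f ∈ maximalIdeal R ^ n := not_not.1 (Nat.find_min hex (by omega))
  refine ⟨n, ⟨hmem, fun i hi => ?_⟩, le_antisymm ?_ (natCast_le_of_mem_pow hv n hmem)⟩
  · by_contra! h
    exact hnot (Ideal.pow_le_pow_right h hi)
  · by_contra! h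
    obtain ⟨c, hc, hfc⟩ := exists_augGE_of_lt (f := f) h
    refine hnot (hfc.mem_maximalIdeal_pow hdim hm _ ?_)
    rw [Nat.cast_add, Nat.cast_one]
    exact ENNReal.add_lt_add_right ENNReal.one_ne_top hc

end Multiplicity

/-! ### The valuation space in terms of `ℝ≥0∞`-valued valuations; its root. -/

section Space

open IsLocalRing

/-- The embedding of `ℝ≥0∞` into `ℝ ∪ {∞}`. -/
noncomputable def toWithTopReal : ℝ≥0∞ →+ WithTop ℝ where
  toFun c := WithTop.map (NNReal.toRealHom : NNReal → ℝ) c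
  map_zero' := rfl
  map_add' a b := WithTop.map_add NNReal.toRealHom a b

theorem toWithTopReal_strictMono : StrictMono toWithTopReal :=
  WithTop.strictMono_map_iff.2 fun _ _ h => h

theorem toWithTopReal_top : toWithTopReal ⊤ = ⊤ := rfl

theorem toWithTopReal_natCast (n : ℕ) : toWithTopReal n = ((n : ℝ) : WithTop ℝ) := by
  change ((NNReal.toRealHom (n : NNReal) : ℝ) : WithTop ℝ) = _
  simp

theorem toWithTopReal_one : toWithTopReal 1 = 1 := by
  simpa using toWithTopReal_natCast 1

theorem toWithTopReal_nonneg (c : ℝ≥0∞) : 0 ≤ toWithTopReal c := by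
  rw [← map_zero toWithTopReal]
  exact toWithTopReal_strictMono.monotone zero_le

theorem exists_toWithTopReal_eq {r : WithTop ℝ} (hr : 0 ≤ r) : ∃ c, toWithTopReal c = r := by
  induction r with
  | top => exact ⟨⊤, rfl⟩
  | coe r => exact ⟨ENNReal.ofNNReal ⟨r, WithTop.coe_nonneg.1 hr⟩, rfl⟩

variable {R : Type*} [CommRing R] [IsLocalRing R]

namespace ValuationSpace

/-- The values of a centered valuation, as elements of `ℝ≥0∞`. -/
noncomputable def ennFun (ν : ValuationSpace R) (f : R) : ℝ≥0∞ :=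
  (exists_toWithTopReal_eq (ν.centered.1 f)).choose

theorem toWithTopReal_ennFun (ν : ValuationSpace R) (f : R) :
    toWithTopReal (ν.ennFun f) = ν.val f :=
  (exists_toWithTopReal_eq (ν.centered.1 f)).choose_spec

/-- A centered valuation, as a valuation with values in `ℝ≥0∞`. -/
noncomputable def enn (ν : ValuationSpace R) : AddValuation R ℝ≥0∞ :=
  AddValuation.of ν.ennFun
    (toWithTopReal_strictMono.injective (by simp [toWithTopReal_ennFun, toWithTopReal_top]))
    (toWithTopReal_strictMono.injective (by simp [toWithTopReal_ennFun]))
    (fun f g => by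
      rw [← toWithTopReal_strictMono.le_iff_le, toWithTopReal_strictMono.monotone.map_min]
      simp only [toWithTopReal_ennFun]
      exact ν.val.map_add f g)
    (fun f g => toWithTopReal_strictMono.injective (by simp [toWithTopReal_ennFun]))

theorem toWithTopReal_enn (ν : ValuationSpace R) (f : R) : toWithTopReal (ν.enn f) = ν.val f :=
  ν.toWithTopReal_ennFun f

theorem le_iff_enn {μ ν : ValuationSpace R} : μ ≤ ν ↔ ∀ f, μ.enn f ≤ ν.enn f := by
  simp only [← toWithTopReal_strictMono.le_iff_le, toWithTopReal_enn]
  rfl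

theorem one_le_enn (ν : ValuationSpace R) {f : R} (hf : f ∈ maximalIdeal R) : 1 ≤ ν.enn f := by
  rw [← toWithTopReal_strictMono.le_iff_le, toWithTopReal_enn, toWithTopReal_one]
  exact ν.normalized.1 ⟨f, hf, rfl⟩

theorem enn_eq_one_or {x y : R} (hm : maximalIdeal R = Ideal.span {x, y}) (ν : ValuationSpace R) :
    ν.enn x = 1 ∨ ν.enn y = 1 := by
  have h : min (ν.enn x) (ν.enn y) ≤ 1 := by
    rw [← toWithTopReal_strictMono.le_iff_le, toWithTopReal_one]
    refine ν.normalized.2 ?_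
    rintro _ ⟨f, hf, rfl⟩
    rw [SetLike.mem_coe, hm, Ideal.mem_span_pair] at hf
    obtain ⟨a, b, rfl⟩ := hf
    simp only [← toWithTopReal_enn]
    rw [toWithTopReal_strictMono.le_iff_le]
    refine ν.enn.map_le_add ?_ ?_ <;> rw [AddValuation.map_mul]
    exacts [(min_le_left _ _).trans le_add_self, (min_le_right _ _).trans le_add_self]
  rcases min_le_iff.1 h with h | h
  · exact .inl (le_antisymm h (ν.one_le_enn (hm ▸ Ideal.subset_span (by simp))))
  · exact .inr (le_antisymm h (ν.one_le_enn (hm ▸ Ideal.subset_span (by simp))))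

theorem exists_enn_eq (v : AddValuation R ℝ≥0∞) (hv : ∀ f ∈ maximalIdeal R, 1 ≤ v f)
    {z : R} (hz : z ∈ maximalIdeal R) (hvz : v z = 1) : ∃ ν : ValuationSpace R, ν.enn = v := by
  let w : AddValuation R (WithTop ℝ) :=
    v.map toWithTopReal toWithTopReal_top toWithTopReal_strictMono.monotone
  have hw : ∀ f, w f = toWithTopReal (v f) := fun f => rfl
  have hw1 : ∀ f ∈ maximalIdeal R, 1 ≤ w f := fun f hf => by
    rw [hw, ← toWithTopReal_one, toWithTopReal_strictMono.le_iff_le]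
    exact hv f hf
  have hwz : w z = 1 := by rw [hw, hvz, toWithTopReal_one]
  refine ⟨⟨w, ⟨fun f => toWithTopReal_nonneg _, fun f hf => zero_lt_one.trans_le (hw1 f hf)⟩,
    ⟨⟨z, ?_, ?_⟩, z, hz, ?_⟩, ⟨?_, fun b hb => ?_⟩⟩, ?_⟩
  · rintro rfl
    simp at hwz
  · simp [hwz]
  · simp [hwz]
  · rintro _ ⟨f, hf, rfl⟩
    exact hw1 f hf
  · exact hwz ▸ hb ⟨z, hz, rfl⟩
  · refine AddValuation.ext fun f => toWithTopReal_strictMono.injective ?_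
    rw [toWithTopReal_enn, ← hw]

end ValuationSpace

theorem exists_multiplicityValuation [IsNoetherianRing R] (hdim : ringKrullDim R = 2) {x y : R}
    (hm : maximalIdeal R = Ideal.span {x, y}) :
    ∃ ν₀ : ValuationSpace R, IsMultiplicityValuation ν₀.val ∧ ∀ ν, ν₀ ≤ ν := by
  have := isDomain_of_dim_two hdim hm
  obtain ⟨v, hv, hvy, hmult⟩ := exists_multiplicity_addValuation hdim hm
  obtain ⟨ν₀, rfl⟩ := ValuationSpace.exists_enn_eq v hv (mem_span_pair_right hm) hvy
  refine ⟨ν₀, fun f hf => ?_, fun ν => ValuationSpace.le_iff_enn.2 fun f => ?_⟩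
  · obtain ⟨n, hn, h⟩ := hmult f hf
    exact ⟨n, hn, by rw [← ν₀.toWithTopReal_enn, h, toWithTopReal_natCast]⟩
  · by_cases hf : f = 0
    · simp [hf]
    · obtain ⟨n, hn, h⟩ := hmult f hf
      rw [h]
      exact natCast_le_of_mem_pow (fun f hf => ν.one_le_enn hf) n hn.1

end Space

end ValuativeTree

namespace ValuativeTree

open IsLocalRing

/-! ### Key elements of minimal degree for a pair of valuations. -/

section Pairs

variable {R : Type*} [CommRing R] {x y : R}

/-- `φ` has order `d` modulo `x`, its values under `μ ≤ ν` differ, and `μ` and `ν` agree on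
elements of smaller order. -/
structure IsMinimalKey (x y : R) (μ ν : AddValuation R ℝ≥0∞) (d : ℕ) (φ : R) : Prop where
  hasDeg : HasDeg x y d φ
  le : ∀ f, μ f ≤ ν f
  lt : μ φ < ν φ
  eq_of_lt : ∀ e < d, ∀ f, HasDeg x y e f → μ f = ν f

variable {μ ν τ : AddValuation R ℝ≥0∞} {d : ℕ} {φ : R}

theorem IsMinimalKey.eq_of_isReduced (h : IsMinimalKey x y μ ν d φ) (hx : μ x = ν x) {f : R}
    (hf : IsReduced x y d f) : μ f = ν f := by
  rcases hf with rfl | ⟨k, e, f', he, hf', rfl⟩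
  · simp
  · rw [μ.map_mul, ν.map_mul, μ.map_pow, ν.map_pow, hx, h.eq_of_lt e he f' hf']

variable [IsLocalRing R]

theorem IsMinimalKey.mem_maximalIdeal (h : IsMinimalKey x y μ ν d φ) : φ ∈ maximalIdeal R := by
  intro hu
  have := h.lt
  rw [map_isUnit μ hu, map_isUnit ν hu] at this
  exact lt_irrefl _ this

variable [IsNoetherianRing R]

theorem IsMinimalKey.isKey (hm : maximalIdeal R = Ideal.span {x, y})
    (h : IsMinimalKey x y μ ν d φ) (hx : μ x = ν x) : IsKey μ ν φ where
  le := h.le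
  lt := h.lt
  exists_div f := by
    obtain ⟨r, q, hf, hr⟩ := h.hasDeg.exists_div hm f
    exact ⟨r, q, hf, h.eq_of_isReduced hx hr⟩

theorem exists_isMinimalKey (hm : maximalIdeal R = Ideal.span {x, y}) (hle : ∀ f, μ f ≤ ν f)
    (hx : μ x = ν x) (hne : ∃ f, μ f ≠ ν f) : ∃ d φ, IsMinimalKey x y μ ν d φ := by
  classical
  have hex : ∃ d φ, HasDeg x y d φ ∧ μ φ < ν φ := by
    obtain ⟨f, hf⟩ := hne
    have hf0 : f ≠ 0 := by
      rintro rfl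
      simp at hf
    obtain ⟨k, d, f', hd, rfl⟩ := exists_pow_mul_hasDeg hm hf0
    refine ⟨d, f', hd, lt_of_le_of_ne (hle f') fun h => hf ?_⟩
    rw [μ.map_mul, ν.map_mul, μ.map_pow, ν.map_pow, hx, h]
  obtain ⟨φ, hd, hlt⟩ := Nat.find_spec hex
  refine ⟨Nat.find hex, φ, hd, hle, hlt, fun e he f hf => le_antisymm (hle f) ?_⟩
  by_contra! hc
  exact Nat.find_min hex he ⟨f, hf, hc⟩

/-- Here `f = r + q * φ` with `r` reduced and `q` a unit, and `r` cannot cancel `q * φ` under `μ`.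
So `φ` has the largest `μ`-value in its degree. -/
theorem IsMinimalKey.map_le_of_hasDeg (hm : maximalIdeal R = Ideal.span {x, y})
    (h : IsMinimalKey x y μ ν d φ) (hx : μ x = ν x) {f : R} (hf : HasDeg x y d f) : μ f ≤ μ φ := by
  obtain ⟨r, q, rfl, hr, hq⟩ := h.hasDeg.exists_isUnit_div hm hf
  refine (map_add_mul_key_le h.le h.lt (h.eq_of_isReduced hx hr)).2.trans ?_
  rw [μ.map_mul, map_isUnit μ hq, zero_add]

/-- A valuation below `τ` is determined by `τ` and by its value at a minimal key element. -/
theorem IsMinimalKey.le_of_map_le (hm : maximalIdeal R = Ideal.span {x, y})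
    (h : IsMinimalKey x y μ τ d φ) (hμ : μ x = τ x) (hν : ν x = τ x)
    (hν1 : ∀ f ∈ maximalIdeal R, 1 ≤ ν f)
    (heq : ∀ e < d, ∀ f, HasDeg x y e f → ν f = τ f) (hφ : μ φ ≤ ν φ) (f : R) : μ f ≤ ν f := by
  -- Repeated division by `φ` need not terminate. Truncating at `n` makes an induction possible,
  -- because `1 ≤ ν φ` gains at least 1 at each quotient.
  have key : ∀ (n : ℕ) (f : R), min (μ f) n ≤ ν f := by
    intro n
    induction n with
    | zero => simp
    | succ n ih =>
      intro f
      obtain ⟨r, q, rfl, hr⟩ := h.hasDeg.exists_div hm f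
      have hμr := h.eq_of_isReduced hμ hr
      have hνr : ν r = τ r := by
        rcases hr with rfl | ⟨k, e, f', he, hf', rfl⟩
        · simp
        · rw [ν.map_mul, τ.map_mul, ν.map_pow, τ.map_pow, hν, heq e he f' hf']
      obtain ⟨h₁, h₂⟩ := map_add_mul_key_le (q := q) h.le h.lt hμr
      refine ν.map_le_add ((min_le_left _ _).trans (h₁.trans (hμr.trans hνr.symm).le)) ?_
      rw [ν.map_mul]
      have h1 := hν1 φ (h.mem_maximalIdeal)
      rcases le_total (μ q) n with hn | hn
      · have := ih q
        rw [min_eq_left hn] at this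
        rw [μ.map_mul] at h₂
        exact (min_le_left _ _).trans (h₂.trans (add_le_add this hφ))
      · have := ih q
        rw [min_eq_right hn] at this
        refine (min_le_right _ _).trans ?_
        rw [Nat.cast_add, Nat.cast_one]
        exact add_le_add this h1
  by_contra! hc
  obtain ⟨n, hn⟩ := ENNReal.exists_nat_gt (ne_top_of_lt hc)
  exact (key n f).not_gt (lt_min hc hn)

end Pairs

/-! ### Order structure below a given valuation. -/

namespace ValuationSpace

variable {R : Type*} [CommRing R] [IsLocalRing R] {x y : R}

theorem enn_left_eq_one (hm : maximalIdeal R = Ideal.span {x, y}) {σ τ : ValuationSpace R}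
    (h : σ ≤ τ) (hτ : τ.enn x = 1) : σ.enn x = 1 :=
  le_antisymm (hτ ▸ le_iff_enn.1 h x) (σ.one_le_enn (mem_span_pair_left hm))

theorem exists_enn_ne {σ τ : ValuationSpace R} (h : σ ≠ τ) : ∃ f, σ.enn f ≠ τ.enn f := by
  by_contra! hc
  exact h (le_antisymm (le_iff_enn.2 fun f => (hc f).le) (le_iff_enn.2 fun f => (hc f).ge))

theorem exists_pair_enn_eq_one (hm : maximalIdeal R = Ideal.span {x, y}) (τ : ValuationSpace R) :
    ∃ a b : R, maximalIdeal R = Ideal.span {a, b} ∧ τ.enn a = 1 := by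
  rcases τ.enn_eq_one_or hm with h | h
  · exact ⟨x, y, hm, h⟩
  · exact ⟨y, x, span_pair_swap hm, h⟩

variable [IsNoetherianRing R]

theorem exists_isMinimalKey_of_lt (hm : maximalIdeal R = Ideal.span {x, y})
    {σ τ : ValuationSpace R} (h : σ < τ) (hτ : τ.enn x = 1) :
    ∃ d φ, IsMinimalKey x y σ.enn τ.enn d φ :=
  exists_isMinimalKey hm (le_iff_enn.1 h.le) ((enn_left_eq_one hm h.le hτ).trans hτ.symm)
    (exists_enn_ne h.ne)

/-- Let `φ` be the key of smaller degree `d`. Both valuations agree with `τ` at `x` and below degree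
`d`, so their values at `φ` decide the comparison. -/
theorem le_total_of_le (hm : maximalIdeal R = Ideal.span {x, y}) {σ σ' τ : ValuationSpace R}
    (h : σ ≤ τ) (h' : σ' ≤ τ) : σ ≤ σ' ∨ σ' ≤ σ := by
  obtain ⟨x, y, hm, hτ⟩ := exists_pair_enn_eq_one hm τ
  rcases h.eq_or_lt with rfl | hlt
  · exact .inr h'
  rcases h'.eq_or_lt with rfl | hlt'
  · exact .inl h
  obtain ⟨d, φ, hφ⟩ := exists_isMinimalKey_of_lt hm hlt hτ
  obtain ⟨d', φ', hφ'⟩ := exists_isMinimalKey_of_lt hm hlt' hτ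
  have hx := (enn_left_eq_one hm h hτ).trans hτ.symm
  have hx' := (enn_left_eq_one hm h' hτ).trans hτ.symm
  wlog hd : d ≤ d' generalizing σ σ' d d' φ φ'
  · exact (this h' h hlt' hlt d' φ' hφ' d φ hφ hx' hx (le_of_not_ge hd)).symm
  rcases le_or_gt (σ.enn φ) (σ'.enn φ) with hle | hgt
  · exact .inl <| le_iff_enn.2 <| hφ.le_of_map_le hm hx hx' (fun f hf => σ'.one_le_enn hf)
      (fun e he => hφ'.eq_of_lt e (he.trans_le hd)) hle
  -- As `σ' φ < σ φ < τ φ`, the element `φ` is a minimal key for `σ'` as well, and the roles can be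
  -- exchanged.
  · have hk : IsMinimalKey x y σ'.enn τ.enn d φ :=
      ⟨hφ.hasDeg, hφ'.le, hgt.trans hφ.lt, fun e he => hφ'.eq_of_lt e (he.trans_le hd)⟩
    exact .inr <| le_iff_enn.2 <| hk.le_of_map_le hm hx' hx (fun f hf => σ.one_le_enn hf)
      hφ.eq_of_lt hgt.le

theorem isChain_of_forall_le (hm : maximalIdeal R = Ideal.span {x, y}) {τ : ValuationSpace R}
    {S : Set (ValuationSpace R)} (hS : ∀ σ ∈ S, σ ≤ τ) : IsChain (· ≤ ·) S :=
  fun _ hσ _ hρ _ => le_total_of_le hm (hS _ hσ) (hS _ hρ)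

/-- Above `σ` and below `τ` there are valuations arbitrarily close to `σ`. -/
theorem exists_lt_le_mul (hm : maximalIdeal R = Ideal.span {x, y}) {σ τ : ValuationSpace R}
    (h : σ < τ) {t : ℝ≥0∞} (ht : 1 < t) (htop : t ≠ ⊤) :
    ∃ ρ : ValuationSpace R, σ < ρ ∧ ρ ≤ τ ∧ ∀ f, ρ.enn f ≤ t * σ.enn f := by
  obtain ⟨x, y, hm, hτ⟩ := exists_pair_enn_eq_one hm τ
  obtain ⟨d, φ, hφ⟩ := exists_isMinimalKey_of_lt hm h hτ
  have hk := hφ.isKey hm ((enn_left_eq_one hm h.le hτ).trans hτ.symm)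
  have hφ1 : 1 ≤ σ.enn φ := σ.one_le_enn (hφ.mem_maximalIdeal)
  have hφtop : σ.enn φ ≠ ⊤ := hφ.lt.ne_top
  have hφt : σ.enn φ < t * σ.enn φ := by
    have := ENNReal.mul_lt_mul_left (zero_lt_one.trans_le hφ1).ne' hφtop ht
    rwa [one_mul] at this
  -- The first bound keeps the augmentation below `t * σ`, the second keeps it below `τ`.
  set γ := min (t * σ.enn φ) (τ.enn φ) with hγdef
  have hσγ : σ.enn φ < γ := lt_min hφt hφ.lt
  have hγτ : γ ≤ τ.enn φ := min_le_right _ _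
  have hγtop : γ ≠ ⊤ := ne_top_of_le_ne_top (ENNReal.mul_ne_top htop hφtop) (min_le_left _ _)
  have hγ0 : 0 < γ := bot_lt_of_lt hσγ
  let v := augmentation hk hγ0 hσγ.le hγτ hγtop
  have hσv : ∀ f, σ.enn f ≤ v f := le_augFun
  have hvτ : ∀ f, v f ≤ τ.enn f :=
    augFun_le_of_le τ.enn.map_add τ.enn.map_mul (le_iff_enn.1 h.le) hγτ
  obtain ⟨ρ, hρ⟩ := exists_enn_eq v (fun f hf => (σ.one_le_enn hf).trans (hσv f))
    (mem_span_pair_left hm) (le_antisymm (hτ ▸ hvτ x)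
      ((σ.one_le_enn (mem_span_pair_left hm)).trans (hσv x)))
  refine ⟨ρ, lt_of_le_of_ne (le_iff_enn.2 (hρ ▸ hσv)) ?_, le_iff_enn.2 (hρ ▸ hvτ), hρ ▸ ?_⟩
  · rintro rfl
    have : v φ = γ := augFun_key hk hσγ.le hγτ
    rw [← hρ] at this
    exact hσγ.ne this
  -- The function `t * σ` satisfies the sum and product laws, dominates `σ`, and is at least `γ` at
  -- `φ`; minimality of the augmentation applies.
  · refine augFun_le_of_le (ρ := fun f => t * σ.enn f) (fun f g => ?_) (fun f g => ?_)
      (fun f => ?_) (min_le_left _ _)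
    · rcases min_le_iff.1 (σ.enn.map_add f g) with h | h
      · exact (min_le_left _ _).trans (mul_le_mul_right h t)
      · exact (min_le_right _ _).trans (mul_le_mul_right h t)
    · simp only [AddValuation.map_mul, mul_add]
    · exact le_mul_of_one_le_left' ht.le

end ValuationSpace

end ValuativeTree

namespace ValuativeTree

open IsLocalRing

/-! ### Suprema of chains and degreewise suprema of values. -/

namespace ValuationSpace

variable {R : Type*} [CommRing R] [IsLocalRing R] {x y : R}

/-- The supremum of a non-empty chain is computed pointwise. -/
theorem exists_isLUB_of_isChain (hm : maximalIdeal R = Ideal.span {x, y})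
    {S : Set (ValuationSpace R)} (hS : IsChain (· ≤ ·) S) (hne : S.Nonempty) :
    ∃ τ : ValuationSpace R, IsLUB S τ ∧ ∀ f, τ.enn f = ⨆ σ : S, σ.1.enn f := by
  have := hne.to_subtype
  have hdir : ∀ σ σ' : S, ∃ ρ : S, σ.1 ≤ ρ.1 ∧ σ'.1 ≤ ρ.1 := fun σ σ' => by
    rcases hS.total σ.2 σ'.2 with h | h
    · exact ⟨σ', h, le_rfl⟩
    · exact ⟨σ, le_rfl, h⟩
  have hle : ∀ (σ : S) (f : R), σ.1.enn f ≤ ⨆ σ : S, σ.1.enn f := fun σ f =>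
    le_iSup (fun σ : S => σ.1.enn f) σ
  let v : AddValuation R ℝ≥0∞ := AddValuation.of (fun f => ⨆ σ : S, σ.1.enn f)
    (by simp) (by simp)
    (fun f g => by
      refine le_of_forall_lt fun c hc => ?_
      obtain ⟨h₁, h₂⟩ := lt_min_iff.1 hc
      obtain ⟨σ, hσ⟩ := lt_iSup_iff.1 h₁
      obtain ⟨σ', hσ'⟩ := lt_iSup_iff.1 h₂
      obtain ⟨ρ, hρ, hρ'⟩ := hdir σ σ'
      refine lt_of_lt_of_le ?_ (hle ρ _)
      exact ρ.1.enn.map_lt_add (hσ.trans_le (le_iff_enn.1 hρ f))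
        (hσ'.trans_le (le_iff_enn.1 hρ' g)))
    (fun f g => by
      simp only [AddValuation.map_mul]
      refine (ENNReal.iSup_add_iSup fun σ σ' => ?_).symm
      obtain ⟨ρ, hρ, hρ'⟩ := hdir σ σ'
      exact ⟨ρ, add_le_add (le_iff_enn.1 hρ f) (le_iff_enn.1 hρ' g)⟩)
  have hv : ∀ f, v f = ⨆ σ : S, σ.1.enn f := fun f => rfl
  have hv1 : ∀ f ∈ maximalIdeal R, 1 ≤ v f := fun f hf => by
    obtain ⟨σ, hσ⟩ := hne
    exact (σ.one_le_enn hf).trans (hle ⟨σ, hσ⟩ f)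
  -- If both generators had value above 1 in the supremum, a single member of the chain would
  -- already exceed 1 at both.
  have hz : ∃ z ∈ maximalIdeal R, v z = 1 := by
    by_contra! hc
    have hx := mem_span_pair_left hm
    have hy := mem_span_pair_right hm
    have h₁ := lt_of_le_of_ne (hv1 x hx) (hc x hx).symm
    have h₂ := lt_of_le_of_ne (hv1 y hy) (hc y hy).symm
    rw [hv, lt_iSup_iff] at h₁ h₂
    obtain ⟨σ, hσ⟩ := h₁
    obtain ⟨σ', hσ'⟩ := h₂
    obtain ⟨ρ, hρ, hρ'⟩ := hdir σ σ'
    rcases ρ.1.enn_eq_one_or hm with h | h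
    · exact (hσ.trans_le (le_iff_enn.1 hρ x)).ne' h
    · exact (hσ'.trans_le (le_iff_enn.1 hρ' y)).ne' h
  obtain ⟨z, hzm, hz⟩ := hz
  obtain ⟨τ, hτ⟩ := exists_enn_eq v hv1 hzm hz
  refine ⟨τ, ⟨fun σ hσ => ?_, fun ρ hρ => ?_⟩, fun f => by rw [hτ, hv]⟩
  · rw [le_iff_enn, hτ]
    exact hle ⟨σ, hσ⟩
  · rw [le_iff_enn, hτ]
    exact fun f => iSup_le fun σ => le_iff_enn.1 (hρ σ.2) f

/-- The supremum of the values on the elements of order `d` modulo `x`. -/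
noncomputable def supDeg (x y : R) (d : ℕ) (σ : ValuationSpace R) : ℝ≥0∞ :=
  ⨆ f : {f // HasDeg x y d f}, σ.enn f

theorem supDeg_mono (d : ℕ) {σ τ : ValuationSpace R} (h : σ ≤ τ) :
    supDeg x y d σ ≤ supDeg x y d τ :=
  iSup_mono fun f => le_iff_enn.1 h f

theorem supDeg_le_mul (d : ℕ) {σ ρ : ValuationSpace R} {t : ℝ≥0∞}
    (h : ∀ f, ρ.enn f ≤ t * σ.enn f) : supDeg x y d ρ ≤ t * supDeg x y d σ :=
  iSup_le fun f => (h f).trans (mul_le_mul_right (le_iSup (fun f : {f // HasDeg x y d f} =>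
    σ.enn f) f) t)

theorem supDeg_eq_iSup (d : ℕ) {S : Set (ValuationSpace R)} {τ : ValuationSpace R}
    (h : ∀ f, τ.enn f = ⨆ σ : S, σ.1.enn f) :
    supDeg x y d τ = ⨆ σ : S, supDeg x y d σ.1 := by
  simp only [supDeg, h]
  exact iSup_comm

/-- In the degree of a minimal key `φ`, the supremum for `σ` is attained at `φ`, where `τ` is
strictly larger. -/
theorem exists_supDeg_lt [IsNoetherianRing R] (hm : maximalIdeal R = Ideal.span {x, y})
    {σ τ : ValuationSpace R} (h : σ < τ) (hτ : τ.enn x = 1) :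
    ∃ d, supDeg x y d σ < supDeg x y d τ := by
  obtain ⟨d, φ, hφ⟩ := exists_isMinimalKey_of_lt hm h hτ
  refine ⟨d, ?_⟩
  calc supDeg x y d σ ≤ σ.enn φ := iSup_le fun f =>
        hφ.map_le_of_hasDeg hm ((enn_left_eq_one hm h.le hτ).trans hτ.symm) f.2
    _ < τ.enn φ := hφ.lt
    _ ≤ supDeg x y d τ := le_iSup (fun f : {f // HasDeg x y d f} => τ.enn f) ⟨φ, hφ.hasDeg⟩

end ValuationSpace

/-! ### A real parameter on chains and the tree axioms. -/

section Parametrization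

/-- The increasing bijection `c ↦ c / (1 + c)` from `[0, ∞]` to `[0, 1]`. -/
noncomputable def squash (c : ℝ≥0∞) : ℝ≥0∞ := (1 + c⁻¹)⁻¹

theorem squash_strictMono : StrictMono squash := fun a b h => by
  rw [squash, squash, ENNReal.inv_lt_inv]
  exact ENNReal.add_lt_add_left ENNReal.one_ne_top (ENNReal.inv_lt_inv.2 h)

theorem squash_le_one (c : ℝ≥0∞) : squash c ≤ 1 :=
  ENNReal.inv_le_one.2 le_self_add

/-- This lets a bound `ρ ≤ t * σ` pass to the parameter, giving its continuity from above. -/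
theorem squash_mul_le {t : ℝ≥0∞} (ht : 1 ≤ t) (htop : t ≠ ⊤) (c : ℝ≥0∞) :
    squash (t * c) ≤ t * squash c := by
  have ht0 : t ≠ 0 := (zero_lt_one.trans_le ht).ne'
  have h : t * squash c = (t⁻¹ * (1 + c⁻¹))⁻¹ := by
    rw [squash, ENNReal.mul_inv (.inl (ENNReal.inv_ne_zero.2 htop))
      (.inl (ENNReal.inv_ne_top.2 ht0)), inv_inv]
  rw [h, squash, ENNReal.inv_le_inv, ENNReal.mul_inv (.inl ht0) (.inl htop), mul_add, mul_one]
  gcongr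
  exact ENNReal.inv_le_one.2 ht

theorem squash_iSup {ι : Type*} [Nonempty ι] (c : ι → ℝ≥0∞) :
    squash (⨆ i, c i) = ⨆ i, squash (c i) := by
  simp only [squash, ENNReal.inv_iSup, ENNReal.add_iInf, ENNReal.inv_iInf]

variable {R : Type*} [CommRing R] [IsLocalRing R] {x y : R}

namespace ValuationSpace

/-- A parametrization of the valuations taking the value `1` at `x`. -/
noncomputable def param (x y : R) (σ : ValuationSpace R) : ℝ≥0∞ :=
  ∑' d : ℕ, 2⁻¹ ^ d * squash (supDeg x y d σ)

theorem param_ne_top (σ : ValuationSpace R) : param x y σ ≠ ⊤ := by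
  refine ne_top_of_le_ne_top (b := ∑' d : ℕ, (2⁻¹ : ℝ≥0∞) ^ d) ?_
    (ENNReal.tsum_le_tsum fun d => mul_le_of_le_one_right' (squash_le_one _))
  rw [ENNReal.tsum_geometric]
  simp

theorem param_mono {σ τ : ValuationSpace R} (h : σ ≤ τ) : param x y σ ≤ param x y τ :=
  ENNReal.tsum_le_tsum fun d => mul_le_mul_right (squash_strictMono.monotone (supDeg_mono d h)) _

theorem param_lt [IsNoetherianRing R] (hm : maximalIdeal R = Ideal.span {x, y})
    {σ τ : ValuationSpace R} (h : σ < τ) (hτ : τ.enn x = 1) : param x y σ < param x y τ := by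
  obtain ⟨d, hd⟩ := exists_supDeg_lt hm h hτ
  refine ENNReal.tsum_lt_tsum (i := d) (param_ne_top σ)
    (fun d => mul_le_mul_right (squash_strictMono.monotone (supDeg_mono d h.le)) _) ?_
  exact ENNReal.mul_lt_mul_right (by simp) (by simp) (squash_strictMono hd)

theorem param_le_mul {σ ρ : ValuationSpace R} {t : ℝ≥0∞} (ht : 1 ≤ t) (htop : t ≠ ⊤)
    (h : ∀ f, ρ.enn f ≤ t * σ.enn f) : param x y ρ ≤ t * param x y σ := by
  rw [param, param, ← ENNReal.tsum_mul_left]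
  refine ENNReal.tsum_le_tsum fun d => ?_
  rw [mul_left_comm]
  gcongr
  exact (squash_strictMono.monotone (supDeg_le_mul d h)).trans (squash_mul_le ht htop _)

/-- Continuity from below: degreewise suprema, `squash` and finite sums all commute with suprema of
chains. -/
theorem param_le_of_forall_le {S : Set (ValuationSpace R)} (hS : IsChain (· ≤ ·) S)
    (hne : S.Nonempty) {τ : ValuationSpace R} (h : ∀ f, τ.enn f = ⨆ σ : S, σ.1.enn f) {r : ℝ≥0∞}
    (hr : ∀ σ ∈ S, param x y σ ≤ r) : param x y τ ≤ r := by
  have := hne.to_subtype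
  rw [param, ENNReal.tsum_eq_iSup_sum]
  refine iSup_le fun s => ?_
  simp only [supDeg_eq_iSup _ h, squash_iSup, ENNReal.mul_iSup]
  rw [ENNReal.finsetSum_iSup]
  · refine iSup_le fun σ => (ENNReal.sum_le_tsum s).trans (hr σ.1 σ.2)
  · intro σ σ'
    have key : ∀ {σ ρ : S}, σ.1 ≤ ρ.1 → ∀ d : ℕ,
        (2⁻¹ : ℝ≥0∞) ^ d * squash (supDeg x y d σ.1) ≤ 2⁻¹ ^ d * squash (supDeg x y d ρ.1) :=
      fun h d => mul_le_mul_right (squash_strictMono.monotone (supDeg_mono d h)) _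
    rcases hS.total σ.2 σ'.2 with h | h
    · exact ⟨σ', fun d => ⟨key h d, le_rfl⟩⟩
    · exact ⟨σ, fun d => ⟨le_rfl, key h d⟩⟩

variable [IsNoetherianRing R]

/-- Intermediate values: the supremum `s` of the valuations in `[σ, τ]` with parameter at most `r`
still has parameter at most `r`. Were it smaller, a valuation slightly above `s` would also qualify.
-/
theorem exists_param_eq (hm : maximalIdeal R = Ideal.span {x, y}) {σ τ : ValuationSpace R}
    (h : σ ≤ τ) {r : ℝ≥0∞} (hσ : param x y σ ≤ r) (hr : r ≤ param x y τ) :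
    ∃ ρ, σ ≤ ρ ∧ ρ ≤ τ ∧ param x y ρ = r := by
  let A : Set (ValuationSpace R) := {ρ | σ ≤ ρ ∧ ρ ≤ τ ∧ param x y ρ ≤ r}
  have hA : IsChain (· ≤ ·) A := isChain_of_forall_le hm fun ρ hρ => hρ.2.1
  have hσA : σ ∈ A := ⟨le_rfl, h, hσ⟩
  obtain ⟨s, hs, hsup⟩ := exists_isLUB_of_isChain hm hA ⟨σ, hσA⟩
  have hsτ : s ≤ τ := hs.2 fun ρ hρ => hρ.2.1
  have hsr : param x y s ≤ r := param_le_of_forall_le hA ⟨σ, hσA⟩ hsup fun ρ hρ => hρ.2.2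
  refine ⟨s, hs.1 hσA, hsτ, hsr.eq_of_not_lt fun hlt => ?_⟩
  have hsτ' : s < τ := lt_of_le_of_ne hsτ fun he => (hlt.trans_le hr).ne (by rw [he])
  -- The factor is the ratio of `r` to the parameter of `s`; when that parameter is 0, any finite
  -- factor above 1 serves.
  obtain ⟨t, ht, htop, htr⟩ : ∃ t : ℝ≥0∞, 1 < t ∧ t ≠ ⊤ ∧ t * param x y s ≤ r := by
    by_cases h0 : param x y s = 0
    · exact ⟨2, by simp, by simp, by simp [h0]⟩
    · have hrtop : r ≠ ⊤ := ne_top_of_le_ne_top (param_ne_top τ) hr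
      refine ⟨r / param x y s, ?_, ENNReal.div_ne_top hrtop h0, ?_⟩
      · rw [ENNReal.lt_div_iff_mul_lt (.inl h0) (.inl (param_ne_top s)), one_mul]
        exact hlt
      · rw [ENNReal.div_mul_cancel h0 (param_ne_top s)]
  obtain ⟨ρ, hsρ, hρτ, hρ⟩ := exists_lt_le_mul hm hsτ' ht htop
  exact hsρ.not_ge (hs.1 ⟨(hs.1 hσA).trans hsρ.le, hρτ, (param_le_mul ht.le htop hρ).trans htr⟩)

theorem isoRealInterval_of_isChain (hm : maximalIdeal R = Ideal.span {x, y})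
    {S : Set (ValuationSpace R)} (hS : IsChain (· ≤ ·) S) (hconv : S.OrdConnected) :
    IsoRealInterval S := by
  rcases S.eq_empty_or_nonempty with rfl | hne
  · exact ⟨∅, Set.ordConnected_empty, ⟨⟨Equiv.equivOfIsEmpty _ _, fun {a} => a.2.elim⟩⟩⟩
  obtain ⟨τ, hτ, -⟩ := exists_isLUB_of_isChain hm hS hne
  -- The supremum `τ` may lie outside `S`; taking the generator at which `τ` is 1 makes one
  -- parameter valid on all of `S`.
  obtain ⟨x, y, hm, hτx⟩ := exists_pair_enn_eq_one hm τ
  have hle : ∀ σ ρ : S, (param x y σ.1).toReal ≤ (param x y ρ.1).toReal ↔ σ ≤ ρ := by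
    intro σ ρ
    rw [ENNReal.toReal_le_toReal (param_ne_top _) (param_ne_top _)]
    refine ⟨fun h => ?_, fun h => param_mono h⟩
    rcases hS.total σ.2 ρ.2 with h' | h'
    · exact h'
    · rcases eq_or_lt_of_le h' with he | hlt
      · exact (Subtype.ext he).ge
      · exact absurd h (param_lt hm hlt (enn_left_eq_one hm (hτ.1 σ.2) hτx)).not_ge
  let F : S ↪o ℝ := OrderEmbedding.ofMapLEIff (fun σ => (param x y σ.1).toReal) hle
  refine ⟨Set.range F, ⟨?_⟩, ⟨F.orderIso⟩⟩
  rintro _ ⟨σ, rfl⟩ _ ⟨ρ, rfl⟩ r ⟨hr₁, hr₂⟩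
  have hσρ : σ ≤ ρ := (hle σ ρ).1 (hr₁.trans hr₂)
  have hr0 : 0 ≤ r := ENNReal.toReal_nonneg.trans hr₁
  obtain ⟨κ, h₁, h₂, h₃⟩ := exists_param_eq (r := ENNReal.ofReal r) hm hσρ
    ((ENNReal.le_ofReal_iff_toReal_le (param_ne_top _) hr0).2 hr₁)
    ((ENNReal.ofReal_le_iff_le_toReal (param_ne_top _)).2 hr₂)
  refine ⟨⟨κ, hconv.out σ.2 ρ.2 ⟨h₁, h₂⟩⟩, ?_⟩
  change (param x y κ).toReal = r
  rw [h₃, ENNReal.toReal_ofReal hr0]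

theorem isCompleteRootedNonmetricTree (hdim : ringKrullDim R = 2)
    (hm : maximalIdeal R = Ideal.span {x, y}) :
    IsCompleteRootedNonmetricTree (ValuationSpace R) where
  lowerSet_interval τ :=
    isoRealInterval_of_isChain hm (isChain_of_forall_le hm fun _ h => h) Set.ordConnected_Iic
  chain_interval _ hS hconv := isoRealInterval_of_isChain hm hS hconv
  exists_inf S hne := by
    obtain ⟨ν₀, -, h₀⟩ := exists_multiplicityValuation hdim hm
    obtain ⟨τ, hτ⟩ := hne
    -- The lower bounds form a chain, being all below `τ`, and include the root; their supremum is
    -- the infimum of `S`.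
    obtain ⟨σ, hσ, -⟩ := exists_isLUB_of_isChain hm
      (isChain_of_forall_le hm (S := lowerBounds S) fun σ hσ => hσ hτ) ⟨ν₀, fun ρ _ => h₀ ρ⟩
    exact ⟨σ, isLUB_lowerBounds.1 hσ⟩
  exists_majorant τ hτ := by
    obtain ⟨τ', h, -⟩ := exists_isLUB_of_isChain hm hτ.isChain_range (Set.range_nonempty τ)
    exact ⟨τ', fun i => h.1 ⟨i, rfl⟩⟩

end ValuationSpace

end Parametrization

end ValuativeTree

theorem mainTheorem1 (R : Type*) [CommRing R] [IsRegularLocalRing R]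
    (hdim : ringKrullDim R = 2) :
    ValuativeTree.IsCompleteRootedNonmetricTree (ValuativeTree.ValuationSpace R) ∧
      ∃ ν₀ : ValuativeTree.ValuationSpace R,
        ValuativeTree.IsMultiplicityValuation ν₀.val ∧ ∀ ν, ν₀ ≤ ν := by
  obtain ⟨x, y, hm⟩ := ValuativeTree.exists_maximalIdeal_eq_span_pair hdim
  exact ⟨ValuativeTree.ValuationSpace.isCompleteRootedNonmetricTree hdim hm,
    ValuativeTree.exists_multiplicityValuation hdim hm⟩
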